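/- **The game.** Let $G=(V,E)$ be a finite undirected simple graph and $N[x]$ the closed neighbourhood of a vertex $x$. In the concurrent game of Selfish Cops and Passive Robber (SCPR) two cops $C_1,C_2$ and a robber $R$ occupy vertices $x^1,x^2,x^3$. The states are the triples $s=(x^1,x^2,x^3)\in\widehat{\mathbf S}_a=V^3$ and a terminal state $\tau$; put $\widehat{\mathbf S}=V^3\cup\{\tau\}$. At a triple $s$, token $i$ may move to any $a^i\in N[x^i]$; at $\tau$ each token has only a null move. The three tokens move simultaneously. A capture state (a triple with $x^1=x^3$ or $x^2=x^3$) and $\tau$ are always followed by $\tau$. From a non-capture state the moves $a^1,a^2,a^3$ lead to $(a^1,a^2,a^3)$, except that if for some $i\in\{1,2\}$ cop $i$ and the robber exchange positions ($a^i=x^3$ and $a^3=x^i$, en-passant capture), the next state is $(a^1,a^2,x^3)$. The immediate payoff is $q(s)=1$ if $s=(x^1,x^2,x^3)$ with $x^1=x^3$, and $q(s)=0$ otherwise (including $q(\tau)=0$). A strategy $\sigma_i$ of token $i$ assigns to every finite history $s_0s_1\dots s_t$ of states a probability distribution on the legal moves of token $i$ at $s_t$; it is stationary Markovian if this distribution depends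 only on $s_t$. Given the history, the three tokens choose their moves independently. The robber's strategy $\sigma_3$ is fixed and known. A triple $(\sigma_1,\sigma_2,\sigma_3)$ and a starting state $s_0$ determine a probability measure on infinite plays; let $J(\sigma_1,\sigma_2\mid s_0)=\mathbb E\left[\sum_{t=0}^\infty q(s_t)\right]$, which $C_1$ maximizes and $C_2$ minimizes. The game starting at $s_0$ has the value $v(s_0)$ if $$v(s_0)=\sup_{\sigma_1}\inf_{\sigma_2}J(\sigma_1,\sigma_2\mid s_0)=\inf_{\sigma_2}\sup_{\sigma_1}J(\sigma_1,\sigma_2\mid s_0),$$ where $\sigma_1,\sigma_2$ range over all strategies. $\mathbf{Val}$ denotes the mixed-strategy value of a finite zero-sum matrix game whose rows and columns are the legal moves $a^1$ of $C_1$ and $a^2$ of $C_2$ at the current state. **Theorem.** (a) Let $\sigma_3$ be any stationary Markovian (possibly randomized) robber strategy, and let $\Pr(s'\mid s,a^1,a^2)$ be the resulting transition probabilities. Define $$v^{(0)}(\tau)=0,\qquad v^{(0)}(s)=q(s)\quad(s\in\widehat{\mathbf S}_a),$$ and, for $i\ge 1$, $$v^{(i)}(\tau)=0,\qquad v^{(i)}(s)=\mathbf{Val}\Big[q(s)+\sum_{s'\in\widehat{\mathbf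 S}}\Pr(s'\mid s,a^1,a^2)\,v^{(i-1)}(s')\Big]\quad(s\in\widehat{\mathbf S}_a).$$ Then for every $s\in\widehat{\mathbf S}_a$ the game starting at $s$ has a value $v(s)$, the limit $\lim_{i\to\infty}v^{(i)}(s)$ exists, and it equals $v(s)$. (b) Let $\sigma_3$ be an arbitrary, possibly history-dependent, robber strategy. For a finite history $h$ with last state $s$ let $\Pr(s'\mid h,a^1,a^2)$ be the probability that the next state is $s'$. Define $v^{(0)}(h)=q(s)$ and, for $i\ge1$, $$v^{(i)}(h)=\mathbf{Val}\Big[q(s)+\sum_{s'\in\widehat{\mathbf S}}\Pr(s'\mid h,a^1,a^2)\,v^{(i-1)}(hs')\Big],$$ where $hs'$ is $h$ followed by $s'$. Then for every $s\in\widehat{\mathbf S}_a$ the game starting at $s$ has a value $v(s)$, and $\lim_{i\to\infty}v^{(i)}(h)$ exists and equals $v(s)$ for the one-state history $h=s$. -/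

import Mathlib

open MeasureTheory ProbabilityTheory Filter Topology
open scoped ENNReal

namespace SCPR

/-- The value of the finite zero-sum matrix game with payoff matrix `Γ` (row player maximizes,
column player minimizes), in mixed strategies: the max-min of the expected payoff, which by the
minimax theorem is also its min-max. -/
noncomputable def matrixVal {ι κ : Type*} [Fintype ι] [Fintype κ] (Γ : ι → κ → ℝ) : ℝ :=
  ⨆ x : stdSimplex ℝ ι, ⨅ y : stdSimplex ℝ κ,
    ∑ i, ∑ j, x i * y j * Γ i j

/-- Game states: `some x` is the position vector of the three tokens (`x 0` the first cop,
`x 1` the second cop, `x 2` the robber), and `none` is the terminal state `τ`. -/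
abbrev State (V : Type*) := Option (Fin 3 → V)

instance instMeasurableSpaceState (V : Type*) : MeasurableSpace (State V) := ⊤

instance instDiscreteMeasurableSpaceState (V : Type*) : DiscreteMeasurableSpace (State V) :=
  ⟨fun _ => trivial⟩

/-- Moves of a single token: `some a` is the move to the vertex `a`, and `none` is the null
move `λ`. -/
abbrev Move (V : Type*) := Option V

open Classical in
/-- The moves available to token `i`: the closed neighbourhood of its position, and only the
null move in the terminal state. -/
noncomputable def moves {V : Type*} [Fintype V] (G : SimpleGraph V) (i : Fin 3) :
    State V → Finset (Move V)
  | some x => (Finset.univ.filter fun a : V => a = x i ∨ G.Adj (x i) a).image some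
  | none => {none}

open Classical in
/-- The next state when the tokens make the moves `a₁, a₂, a₃` simultaneously. Capture states and
the terminal state go to the terminal state. If a cop and the robber swap the ends of an edge
(en-passant capture), the robber ends at the destination of that cop. The null move is never legal
outside the terminal state, so those cases of the last line are irrelevant. -/
noncomputable def step {V : Type*} : State V → Move V → Move V → Move V → State V
  | some x, some a₁, some a₂, some a₃ =>
      if x 0 = x 2 ∨ x 1 = x 2 then none
      else if (a₁ = x 2 ∧ a₃ = x 0) ∨ (a₂ = x 2 ∧ a₃ = x 1) then some ![a₁, a₂, x 2]
      else some ![a₁, a₂, a₃]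
  | _, _, _, _ => none

open Classical in
/-- Immediate payoff to the first cop: `1` at the states where he captures the robber, `0` at all
other states. -/
noncomputable def q {V : Type*} : State V → ℝ
  | some x => if x 0 = x 2 then 1 else 0
  | none => 0

/-- Histories `s₀ s₁ … sₙ`. -/
abbrev History (V : Type*) (n : ℕ) := (k : Finset.Iic n) → State V

/-- The current (last) state of a history. -/
def History.last {V : Type*} {n : ℕ} (h : History V n) : State V :=
  h ⟨n, Finset.mem_Iic.2 le_rfl⟩

/-- The history of length one consisting of the starting state. -/
def History.start {V : Type*} (s : State V) : History V 0 := fun _ => s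

/-- The history `h` followed by the state `s`. -/
def History.snoc {V : Type*} {n : ℕ} (h : History V n) (s : State V) : History V (n + 1) :=
  fun k => if hk : (k : ℕ) ≤ n then h ⟨k, Finset.mem_Iic.2 hk⟩ else s

/-- A strategy for token `i`: for every finite history, a probability distribution of the next
move which gives zero probability to illegal moves. -/
structure Strategy {V : Type*} [Fintype V] (G : SimpleGraph V) (i : Fin 3) where
  prob : (n : ℕ) → History V n → PMF (Move V)
  legal : ∀ n (h : History V n) (a : Move V), prob n h a ≠ 0 → a ∈ moves G i h.last

/-- A stationary Markovian strategy for token `i`: the distribution of the next move depends on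
the current state only. -/
structure StationaryStrategy {V : Type*} [Fintype V] (G : SimpleGraph V) (i : Fin 3) where
  prob : State V → PMF (Move V)
  legal : ∀ (s : State V) (a : Move V), prob s a ≠ 0 → a ∈ moves G i s

/-- A stationary Markovian strategy is a strategy. -/
def StationaryStrategy.toStrategy {V : Type*} [Fintype V] {G : SimpleGraph V} {i : Fin 3}
    (ρ : StationaryStrategy G i) : Strategy G i where
  prob _ h := ρ.prob h.last
  legal _ h a ha := ρ.legal h.last a ha

/-- The distribution of the next state from the state `s`, when the cops play `a₁, a₂` and the
robber's move has the distribution `r`. -/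
noncomputable def nextState {V : Type*} (s : State V) (r : PMF (Move V)) (a₁ a₂ : Move V) :
    PMF (State V) :=
  r.map fun a₃ => step s a₁ a₂ a₃

/-- The distribution of the next state after the history `h`, when all three tokens move according
to their strategies, independently of each other given the history. -/
noncomputable def nextLaw {V : Type*} [Fintype V] {G : SimpleGraph V}
    (σ₁ : Strategy G 0) (σ₂ : Strategy G 1) (σ₃ : Strategy G 2) {n : ℕ} (h : History V n) :
    PMF (State V) :=
  (σ₁.prob n h).bind fun a₁ => (σ₂.prob n h).bind fun a₂ =>
    nextState h.last (σ₃.prob n h) a₁ a₂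

/-- `nextLaw` as a Markov kernel. -/
noncomputable def nextKernel {V : Type*} [Fintype V] {G : SimpleGraph V}
    (σ₁ : Strategy G 0) (σ₂ : Strategy G 1) (σ₃ : Strategy G 2) (n : ℕ) :
    Kernel (History V n) (State V) :=
  Kernel.ofFunOfCountable fun h => (nextLaw σ₁ σ₂ σ₃ h).toMeasure

instance instIsMarkovKernelNextKernel {V : Type*} [Fintype V] {G : SimpleGraph V}
    (σ₁ : Strategy G 0) (σ₂ : Strategy G 1) (σ₃ : Strategy G 2) (n : ℕ) :
    IsMarkovKernel (nextKernel σ₁ σ₂ σ₃ n) :=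
  ⟨fun h => PMF.toMeasure.isProbabilityMeasure (nextLaw σ₁ σ₂ σ₃ h)⟩

/-- The probability measure on infinite plays `s₀ s₁ s₂ …` induced by a strategy triple and a
starting state. -/
noncomputable def playMeasure {V : Type*} [Fintype V] {G : SimpleGraph V}
    (σ₁ : Strategy G 0) (σ₂ : Strategy G 1) (σ₃ : Strategy G 2) (s₀ : State V) :
    Measure (ℕ → State V) :=
  Kernel.traj (X := fun _ => State V) (nextKernel σ₁ σ₂ σ₃) 0 (History.start s₀)

/-- The expected total payoff of the first cop, an expectation of a nonnegative variable. -/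
noncomputable def J {V : Type*} [Fintype V] {G : SimpleGraph V}
    (σ₃ : Strategy G 2) (σ₁ : Strategy G 0) (σ₂ : Strategy G 1) (s₀ : State V) : ℝ≥0∞ :=
  ∫⁻ ω, ∑' t, ENNReal.ofReal (q (ω t)) ∂(playMeasure σ₁ σ₂ σ₃ s₀)

/-- The game started at `s₀`, with robber strategy `σ₃`, has a value, and this value is `v`. -/
def IsGameValue {V : Type*} [Fintype V] {G : SimpleGraph V} (σ₃ : Strategy G 2) (s₀ : State V)
    (v : ℝ) : Prop :=
  0 ≤ v ∧
  (⨆ σ₁ : Strategy G 0, ⨅ σ₂ : Strategy G 1, J σ₃ σ₁ σ₂ s₀) = ENNReal.ofReal v ∧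
  (⨅ σ₂ : Strategy G 1, ⨆ σ₁ : Strategy G 0, J σ₃ σ₁ σ₂ s₀) = ENNReal.ofReal v

/-- Value iteration for a stationary Markovian robber, where the probabilities
`Pr(s' | s, a₁, a₂)` depend on the current state only. -/
noncomputable def valueIter {V : Type*} [Fintype V] {G : SimpleGraph V}
    (ρ : StationaryStrategy G 2) : ℕ → State V → ℝ
  | _, none => 0
  | 0, some x => q (some x)
  | i + 1, some x =>
      matrixVal fun (a₁ : moves G 0 (some x)) (a₂ : moves G 1 (some x)) =>
        q (some x) + ∑ s' : State V,
          (nextState (some x) (ρ.prob (some x)) a₁ a₂ s').toReal * valueIter ρ i s'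

/-- Value iteration for a robber whose strategy may depend on the whole history: the same
recursion with the finite histories as the states of the game. -/
noncomputable def histValueIter {V : Type*} [Fintype V] {G : SimpleGraph V}
    (σ₃ : Strategy G 2) : ℕ → {n : ℕ} → History V n → ℝ
  | 0, _, h => q h.last
  | i + 1, n, h =>
      matrixVal fun (a₁ : moves G 0 h.last) (a₂ : moves G 1 h.last) =>
        q h.last + ∑ s' : State V,
          (nextState h.last (σ₃.prob n h) a₁ a₂ s').toReal * histValueIter σ₃ i (h.snoc s')

end SCPR

/-! Positive payoff is collected at most once, since a capture leads to `τ`. Hence the iterates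
`histValueIter` are bounded by 1; they increase with the horizon because the payoff is nonnegative,
so they converge to a limit `histValue`. Upper bound: the limit dominates the value of the one-stage
game with continuation `histValue`. If the second cop plays optimally in that stage game after every
history, the collected payoff plus `histValue` is a supermartingale, and `J` is at most its initial
value. Lower bound: for each `N` the first cop plays optimally in the game truncated at horizon `N`,
which secures the `N`-th iterate because later payoffs are nonnegative. Letting `N` grow closes the
gap. Both bounds rest on the minimax theorem for matrix games, proved here by separating convex
sets. Part (a) reduces to (b): for a stationary robber the iterates depend only on the last state.
-/

namespace SCPR

/-! ### Matrix games and the minimax theorem -/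

section Matrix

variable {ι κ : Type*} [Fintype ι] [Fintype κ]

/-- The expected payoff of the mixed strategies `x` and `y` in the matrix game `Γ`. -/
noncomputable def mixedPayoff (Γ : ι → κ → ℝ) (x : ι → ℝ) (y : κ → ℝ) : ℝ :=
  ∑ i, ∑ j, x i * y j * Γ i j

theorem mixedPayoff_eq_sum_mul (Γ : ι → κ → ℝ) (x : ι → ℝ) (y : κ → ℝ) :
    mixedPayoff Γ x y = ∑ i, x i * ∑ j, y j * Γ i j := by
  simp only [mixedPayoff, Finset.mul_sum, mul_assoc]

theorem mixedPayoff_mono {Γ Γ' : ι → κ → ℝ} (h : ∀ i j, Γ i j ≤ Γ' i j) {x : ι → ℝ} {y : κ → ℝ}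
    (hx : x ∈ stdSimplex ℝ ι) (hy : y ∈ stdSimplex ℝ κ) :
    mixedPayoff Γ x y ≤ mixedPayoff Γ' x y :=
  Finset.sum_le_sum fun i _ => Finset.sum_le_sum fun j _ =>
    mul_le_mul_of_nonneg_left (h i j) (mul_nonneg (hx.1 i) (hy.1 j))

theorem mixedPayoff_const (c : ℝ) {x : ι → ℝ} {y : κ → ℝ}
    (hx : x ∈ stdSimplex ℝ ι) (hy : y ∈ stdSimplex ℝ κ) :
    mixedPayoff (fun _ _ => c) x y = c := by
  simp [mixedPayoff_eq_sum_mul, ← Finset.sum_mul, hx.2, hy.2]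

theorem mixedPayoff_add_const (Γ : ι → κ → ℝ) (c : ℝ) {x : ι → ℝ} {y : κ → ℝ}
    (hx : x ∈ stdSimplex ℝ ι) (hy : y ∈ stdSimplex ℝ κ) :
    mixedPayoff (fun i j => Γ i j + c) x y = mixedPayoff Γ x y + c := by
  conv_rhs => rw [← mixedPayoff_const c hx hy]
  simp only [mixedPayoff, mul_add, Finset.sum_add_distrib]

theorem mixedPayoff_neg_swap (Γ : ι → κ → ℝ) (x : ι → ℝ) (y : κ → ℝ) :
    mixedPayoff (fun j i => -Γ i j) y x = -mixedPayoff Γ x y := by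
  rw [mixedPayoff, Finset.sum_comm]
  simp [mixedPayoff, mul_comm]

/-- Theorem of the alternative for matrix games: either the column player can keep the payoff
below `c`, or the row player can guarantee strictly more than `c`. -/
theorem mixedPayoff_alternative [Nonempty κ] (Γ : ι → κ → ℝ) (c : ℝ) :
    (∃ y ∈ stdSimplex ℝ κ, ∀ x ∈ stdSimplex ℝ ι, mixedPayoff Γ x y ≤ c) ∨
    (∃ x ∈ stdSimplex ℝ ι, ∃ δ > 0, ∀ y ∈ stdSimplex ℝ κ, c + δ ≤ mixedPayoff Γ x y) := by
  classical
  -- `L y` lists the payoffs of the pure rows against `y`, so the column player can hold the payoff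
  -- to `c` exactly when the image of the simplex meets the orthant of vectors `≤ c`.
  let L : (κ → ℝ) →ₗ[ℝ] (ι → ℝ) :=
    LinearMap.pi fun i => ∑ j, Γ i j • LinearMap.proj j
  have hL : ∀ y i, L y i = ∑ j, y j * Γ i j := fun y i => by simp [L, mul_comm]
  have hC : IsCompact (L '' stdSimplex ℝ κ) :=
    (isCompact_stdSimplex (𝕜 := ℝ) (ι := κ)).image L.continuous_of_finiteDimensional
  have hCc : Convex ℝ (L '' stdSimplex ℝ κ) := (convex_stdSimplex ℝ κ).linear_image L
  by_cases hd : Disjoint (Set.Iic fun _ : ι => c) (L '' stdSimplex ℝ κ)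
  · right
    obtain ⟨f, u, v, hu, huv, hv⟩ := geometric_hahn_banach_closed_compact
      (convex_Iic _) isClosed_Iic hCc hC hd
    have hf : ∀ z : ι → ℝ, f z = ∑ i, z i * f (Pi.single i 1) := fun z => by
      conv_lhs => rw [pi_eq_sum_univ' z]
      simp [map_sum]
    -- With a negative coefficient, going down in coordinate `i` would stay in the orthant while
    -- raising `f`; the step length is the one at which `f` reaches `u`, which is excluded.
    have hpos : ∀ i, 0 ≤ f (Pi.single i 1) := by
      intro i
      by_contra! hneg
      set e := f (Pi.single i 1) with he
      have hK := hu (fun _ => c) Set.self_mem_Iic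
      set w := f (fun _ => c)
      have hz := hu ((fun _ => c) - ((u - w) / (-e)) • (Pi.single i 1 : ι → ℝ)) (by
        refine Set.mem_Iic.2 (sub_le_self _ ?_)
        refine smul_nonneg (div_nonneg (by linarith) (by linarith)) ?_
        exact Pi.single_nonneg.2 zero_le_one)
      rw [map_sub, map_smul, ← he, smul_eq_mul] at hz
      have : (u - w) / (-e) * e = -(u - w) := by
        rw [div_neg, neg_mul, div_mul_cancel₀ _ hneg.ne]
      linarith
    have hS0 : 0 ≤ ∑ i, f (Pi.single i 1) := Finset.sum_nonneg fun i _ => hpos i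
    have hfc : f (fun _ => c) = c * ∑ i, f (Pi.single i 1) := by
      rw [hf, Finset.mul_sum]
    obtain ⟨y₀, hy₀⟩ : (stdSimplex ℝ κ).Nonempty :=
      ⟨_, single_mem_stdSimplex ℝ (Classical.arbitrary κ)⟩
    -- Otherwise `f = 0`, which cannot separate two nonempty sets.
    have hS : 0 < ∑ i, f (Pi.single i 1) := by
      refine hS0.lt_of_ne fun h0 => ?_
      have hz : ∀ i, f (Pi.single i 1) = 0 := fun i =>
        (Finset.sum_eq_zero_iff_of_nonneg fun i _ => hpos i).1 h0.symm i (Finset.mem_univ i)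
      have h1 := hu (fun _ => c) Set.self_mem_Iic
      have h2 := hv _ ⟨y₀, hy₀, rfl⟩
      rw [hf] at h1 h2
      simp only [hz, mul_zero, Finset.sum_const_zero] at h1 h2
      linarith
    set S := ∑ i, f (Pi.single i 1)
    -- The normalized separating functional is the row strategy: `c * S < u` and `v < f (L y)`, so
    -- dividing by `S` leaves the margin `(v - u) / S`.
    refine ⟨fun i => f (Pi.single i 1) / S, ⟨fun i => div_nonneg (hpos i) hS.le, ?_⟩,
      (v - u) / S, div_pos (by linarith) hS, fun y hy => ?_⟩
    · rw [← Finset.sum_div, div_self hS.ne']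
    · have h1 := hu (fun _ => c) Set.self_mem_Iic
      have h2 := hv _ ⟨y, hy, rfl⟩
      rw [hfc] at h1
      have h3 : mixedPayoff Γ (fun i => f (Pi.single i 1) / S) y = f (L y) / S := by
        rw [mixedPayoff_eq_sum_mul, hf, Finset.sum_div]
        refine Finset.sum_congr rfl fun i _ => ?_
        rw [hL]; ring
      rw [h3, le_div_iff₀ hS, add_mul, div_mul_cancel₀ _ hS.ne']
      linarith
  · left
    obtain ⟨z, hz, y, hy, rfl⟩ := Set.not_disjoint_iff.1 hd
    refine ⟨y, hy, fun x hx => ?_⟩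
    rw [mixedPayoff_eq_sum_mul]
    calc ∑ i, x i * ∑ j, y j * Γ i j ≤ ∑ i, x i * c := Finset.sum_le_sum fun i _ =>
          mul_le_mul_of_nonneg_left (by simpa [hL] using hz i) (hx.1 i)
      _ = c := by rw [← Finset.sum_mul, hx.2, one_mul]

/-- Supplies the boundedness without which the real `⨆` and `⨅` in `matrixVal` would take default
values. -/
theorem abs_mixedPayoff_le (Γ : ι → κ → ℝ) {x : ι → ℝ} {y : κ → ℝ}
    (hx : x ∈ stdSimplex ℝ ι) (hy : y ∈ stdSimplex ℝ κ) :
    |mixedPayoff Γ x y| ≤ ∑ i, ∑ j, |Γ i j| := by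
  have hle : ∀ i j, |Γ i j| ≤ ∑ i, ∑ j, |Γ i j| := fun i j =>
    (Finset.single_le_sum (f := fun j => |Γ i j|) (fun j _ => abs_nonneg _)
      (Finset.mem_univ j)).trans
    (Finset.single_le_sum (f := fun i => ∑ j, |Γ i j|)
      (fun i _ => Finset.sum_nonneg fun j _ => abs_nonneg _) (Finset.mem_univ i))
  rw [abs_le]
  constructor
  · rw [← mixedPayoff_const (-_) hx hy]
    exact mixedPayoff_mono (fun i j => (abs_le.1 (hle i j)).1) hx hy
  · rw [← mixedPayoff_const (∑ i, ∑ j, |Γ i j|) hx hy]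
    exact mixedPayoff_mono (fun i j => (abs_le.1 (hle i j)).2) hx hy

instance instNonemptyStdSimplex [Nonempty ι] : Nonempty (stdSimplex ℝ ι) := by
  classical exact ⟨⟨_, single_mem_stdSimplex ℝ (Classical.arbitrary ι)⟩⟩

theorem le_matrixVal [Nonempty κ] (Γ : ι → κ → ℝ) (c : ℝ) {x : ι → ℝ} (hx : x ∈ stdSimplex ℝ ι)
    (h : ∀ y ∈ stdSimplex ℝ κ, c ≤ mixedPayoff Γ x y) : c ≤ matrixVal Γ := by
  refine le_ciSup_of_le ⟨∑ i, ∑ j, |Γ i j|, ?_⟩ ⟨x, hx⟩ (le_ciInf fun y => h y y.2)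
  rintro _ ⟨x, rfl⟩
  obtain ⟨y⟩ : Nonempty (stdSimplex ℝ κ) := inferInstance
  refine ciInf_le_of_le ⟨-∑ i, ∑ j, |Γ i j|, ?_⟩ y
    (abs_le.1 (abs_mixedPayoff_le Γ x.2 y.2)).2
  rintro _ ⟨y, rfl⟩
  exact (abs_le.1 (abs_mixedPayoff_le Γ x.2 y.2)).1

theorem matrixVal_le [Nonempty ι] (Γ : ι → κ → ℝ) (c : ℝ) {y : κ → ℝ} (hy : y ∈ stdSimplex ℝ κ)
    (h : ∀ x ∈ stdSimplex ℝ ι, mixedPayoff Γ x y ≤ c) : matrixVal Γ ≤ c := by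
  refine ciSup_le fun x => ciInf_le_of_le ⟨-∑ i, ∑ j, |Γ i j|, ?_⟩ ⟨y, hy⟩ (h x x.2)
  rintro _ ⟨y, rfl⟩
  exact (abs_le.1 (abs_mixedPayoff_le Γ x.2 y.2)).1

/-- The minimax theorem: the column player has a strategy that guarantees `matrixVal Γ`. -/
theorem exists_mixedPayoff_le_matrixVal [Nonempty κ] (Γ : ι → κ → ℝ) :
    ∃ y ∈ stdSimplex ℝ κ, ∀ x ∈ stdSimplex ℝ ι, mixedPayoff Γ x y ≤ matrixVal Γ := by
  refine (mixedPayoff_alternative Γ (matrixVal Γ)).resolve_right ?_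
  rintro ⟨x, hx, δ, hδ, h⟩
  linarith [le_matrixVal Γ _ hx h]

/-- The row player has a strategy that guarantees `matrixVal Γ`. -/
theorem exists_matrixVal_le_mixedPayoff [Nonempty ι] (Γ : ι → κ → ℝ) :
    ∃ x ∈ stdSimplex ℝ ι, ∀ y ∈ stdSimplex ℝ κ, matrixVal Γ ≤ mixedPayoff Γ x y := by
  -- The alternative is applied with the players exchanged; its second case would let the column
  -- player hold the payoff to `matrixVal Γ - δ`.
  rcases mixedPayoff_alternative (fun j i => -Γ i j) (-matrixVal Γ) with
    ⟨x, hx, h⟩ | ⟨y, hy, δ, hδ, h⟩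
  · refine ⟨x, hx, fun y hy => ?_⟩
    have := h y hy
    rw [mixedPayoff_neg_swap] at this
    linarith
  · have := matrixVal_le Γ (matrixVal Γ - δ) hy fun x hx => by
      have := h x hx
      rw [mixedPayoff_neg_swap] at this
      linarith
    linarith

variable [Nonempty ι] [Nonempty κ]

theorem matrixVal_le_matrixVal_add {Γ Γ' : ι → κ → ℝ} {c : ℝ} (h : ∀ i j, Γ i j ≤ Γ' i j + c) :
    matrixVal Γ ≤ matrixVal Γ' + c := by
  obtain ⟨y, hy, hy'⟩ := exists_mixedPayoff_le_matrixVal Γ'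
  refine matrixVal_le _ _ hy fun x hx => (mixedPayoff_mono h hx hy).trans ?_
  rw [mixedPayoff_add_const _ _ hx hy]
  linarith [hy' x hx]

theorem matrixVal_mono {Γ Γ' : ι → κ → ℝ} (h : ∀ i j, Γ i j ≤ Γ' i j) :
    matrixVal Γ ≤ matrixVal Γ' := by
  simpa using matrixVal_le_matrixVal_add (c := 0) (by simpa using h)

theorem matrixVal_const (c : ℝ) : matrixVal (fun (_ : ι) (_ : κ) => c) = c := by
  obtain ⟨x, hx⟩ : Nonempty (stdSimplex ℝ ι) := inferInstance
  obtain ⟨y, hy⟩ : Nonempty (stdSimplex ℝ κ) := inferInstance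
  exact le_antisymm (matrixVal_le _ _ hy fun x hx => (mixedPayoff_const c hx hy).le)
    (le_matrixVal _ _ hx fun y hy => (mixedPayoff_const c hx hy).ge)

end Matrix

/-! ### Expected payoff along a play, and martingale bounds -/

section Play

variable {V : Type*}

theorem History.last_snoc {n : ℕ} (h : History V n) (s : State V) : (h.snoc s).last = s := by
  simp [History.last, History.snoc]

theorem q_nonneg (s : State V) : 0 ≤ q s := by
  rcases s with _ | x
  · exact le_rfl
  · simp only [q]; split_ifs <;> norm_num

theorem q_le_one (s : State V) : q s ≤ 1 := by
  rcases s with _ | x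
  · exact zero_le_one
  · simp only [q]; split_ifs <;> norm_num

variable [Fintype V] {G : SimpleGraph V}
  (σ₁ : Strategy G 0) (σ₂ : Strategy G 1) (σ₃ : Strategy G 2)

/-- The law of the first `n + 1` states of the play. -/
noncomputable def historyLaw (s₀ : State V) (n : ℕ) : Measure (History V n) :=
  Kernel.partialTraj (X := fun _ => State V) (nextKernel σ₁ σ₂ σ₃) 0 n (History.start s₀)

theorem lintegral_historyLaw_zero (s₀ : State V) (f : History V 0 → ℝ≥0∞) :
    ∫⁻ h, f h ∂historyLaw σ₁ σ₂ σ₃ s₀ 0 = f (History.start s₀) := by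
  rw [historyLaw, Kernel.partialTraj_self, Kernel.id_apply,
    lintegral_dirac' _ (measurable_of_countable f)]

theorem lintegral_historyLaw_succ (s₀ : State V) (n : ℕ) (f : History V (n + 1) → ℝ≥0∞) :
    ∫⁻ h, f h ∂historyLaw σ₁ σ₂ σ₃ s₀ (n + 1) =
      ∫⁻ h, ∫⁻ s, f (h.snoc s) ∂(nextLaw σ₁ σ₂ σ₃ h).toMeasure ∂historyLaw σ₁ σ₂ σ₃ s₀ n := by
  have hf : Measurable f := measurable_of_countable f
  rw [historyLaw, Kernel.partialTraj_succ_of_le (Nat.zero_le n),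
    Kernel.map_apply _ (by fun_prop), lintegral_map hf (by fun_prop),
    Kernel.lintegral_comp _ _ _ (by fun_prop)]
  refine lintegral_congr fun h => ?_
  rw [Kernel.lintegral_id_prod (by fun_prop), Kernel.map_apply _ (by fun_prop),
    lintegral_map (by fun_prop) (by fun_prop)]
  refine lintegral_congr fun s => congrArg f ?_
  ext1 k
  simp only [IicProdIoc_def, History.snoc]
  split_ifs
  · rfl
  · have hk : k = ⟨n + 1, Finset.mem_Iic.2 le_rfl⟩ :=
      Subtype.ext (by have := Finset.mem_Iic.1 k.2; simp only; omega)
    subst hk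
    rfl

theorem J_eq_tsum (s₀ : State V) :
    J σ₃ σ₁ σ₂ s₀ = ∑' t, ∫⁻ h, ENNReal.ofReal (q h.last) ∂historyLaw σ₁ σ₂ σ₃ s₀ t := by
  have hq : Measurable fun s : State V => ENNReal.ofReal (q s) := measurable_of_countable _
  rw [J, lintegral_tsum (f := fun t (ω : ℕ → State V) => ENNReal.ofReal (q (ω t)))
    fun t => (hq.comp (measurable_pi_apply t)).aemeasurable]
  refine tsum_congr fun t => ?_
  rw [historyLaw, ← Kernel.traj_map_frestrictLe_apply,
    lintegral_map (measurable_of_countable _) (by fun_prop), playMeasure]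
  rfl

/-- The payoff collected before time `n` plus `W n` has nonincreasing expectation. The leftover `W
n` is nonnegative, so dropping it bounds every partial sum. -/
theorem J_le_of_supermartingale (s₀ : State V) (W : (n : ℕ) → History V n → ℝ≥0∞)
    (hW : ∀ n h, ENNReal.ofReal (q (History.last h)) +
      ∫⁻ s, W (n + 1) (h.snoc s) ∂(nextLaw σ₁ σ₂ σ₃ h).toMeasure ≤ W n h) :
    J σ₃ σ₁ σ₂ s₀ ≤ W 0 (History.start s₀) := by
  have key : ∀ n, ∑ t ∈ Finset.range n,
      ∫⁻ h, ENNReal.ofReal (q h.last) ∂historyLaw σ₁ σ₂ σ₃ s₀ t +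
      ∫⁻ h, W n h ∂historyLaw σ₁ σ₂ σ₃ s₀ n ≤ W 0 (History.start s₀) := by
    intro n
    induction n with
    | zero => simp [lintegral_historyLaw_zero]
    | succ n ih =>
      refine le_trans ?_ ih
      rw [Finset.sum_range_succ, lintegral_historyLaw_succ, add_assoc,
        ← lintegral_add_left (measurable_of_countable _)]
      exact add_le_add_right (lintegral_mono fun h => hW n h) _
  rw [J_eq_tsum, ENNReal.tsum_eq_iSup_nat]
  exact iSup_le fun n => le_self_add.trans (key n)

/-- Here the leftover cannot simply be dropped: `W` has to vanish at some time `N`, so that all of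
its initial value has been collected by then. Payoffs from `N` on only help. -/
theorem le_J_of_submartingale (s₀ : State V) (W : (n : ℕ) → History V n → ℝ≥0∞) (N : ℕ)
    (hW : ∀ n h, W n h ≤ ENNReal.ofReal (q (History.last h)) +
      ∫⁻ s, W (n + 1) (h.snoc s) ∂(nextLaw σ₁ σ₂ σ₃ h).toMeasure)
    (hN : ∀ h, W N h = 0) :
    W 0 (History.start s₀) ≤ J σ₃ σ₁ σ₂ s₀ := by
  have key : ∀ n, W 0 (History.start s₀) ≤ ∑ t ∈ Finset.range n,
      ∫⁻ h, ENNReal.ofReal (q h.last) ∂historyLaw σ₁ σ₂ σ₃ s₀ t +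
      ∫⁻ h, W n h ∂historyLaw σ₁ σ₂ σ₃ s₀ n := by
    intro n
    induction n with
    | zero => simp [lintegral_historyLaw_zero]
    | succ n ih =>
      refine ih.trans ?_
      rw [Finset.sum_range_succ, lintegral_historyLaw_succ, add_assoc,
        ← lintegral_add_left (measurable_of_countable _)]
      exact add_le_add_right (lintegral_mono fun h => hW n h) _
  refine (key N).trans ?_
  simp only [hN, lintegral_zero, add_zero, J_eq_tsum]
  exact ENNReal.sum_le_tsum _

end Play

/-! ### Transitions into the terminal state -/

section NextState

variable {V : Type*}

theorem nextState_none (r : PMF (Move V)) (a₁ a₂ : Move V) :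
    nextState none r a₁ a₂ = PMF.pure none :=
  PMF.map_const r none

theorem nextState_of_capture {x : Fin 3 → V} (hx : x 0 = x 2) (r : PMF (Move V))
    (a₁ a₂ : Move V) : nextState (some x) r a₁ a₂ = PMF.pure none := by
  rw [← PMF.map_const r (none : State V), nextState]
  congr 1
  ext1 a₃
  -- Legality of the moves plays no role: `step` sends any null move to `none` as well.
  rcases a₁ with _ | a₁ <;> rcases a₂ with _ | a₂ <;> rcases a₃ with _ | a₃ <;> simp [step, hx]

end NextState

/-! ### Mixed actions and the one-stage game -/

section Stage

variable {V : Type*} [Fintype V] {G : SimpleGraph V}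

instance instNonemptyMoves (i : Fin 3) (s : State V) : Nonempty (moves G i s) := by
  classical
  rcases s with _ | x
  · exact ⟨⟨none, by simp [moves]⟩⟩
  · exact ⟨⟨some (x i), by simp [moves]⟩⟩

/-- The mixed action prescribed by a strategy after a history. -/
noncomputable def Strategy.weight {i : Fin 3} (σ : Strategy G i) {n : ℕ} (h : History V n)
    (a : moves G i h.last) : ℝ :=
  (σ.prob n h a).toReal

theorem Strategy.sum_prob_mul {i : Fin 3} (σ : Strategy G i) {n : ℕ} (h : History V n)
    (f : Move V → ℝ) :
    ∑ a, (σ.prob n h a).toReal * f a = ∑ a : moves G i h.last, σ.weight h a * f a := by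
  simp only [Strategy.weight]
  rw [Finset.sum_coe_sort (moves G i h.last) fun a => (σ.prob n h a).toReal * f a]
  refine (Finset.sum_subset (Finset.subset_univ _) fun a _ ha => ?_).symm
  have : σ.prob n h a = 0 := by
    by_contra h0
    exact ha (σ.legal n h a h0)
  simp [this]

theorem sum_toReal_eq_one {α : Type*} [Fintype α] (p : PMF α) : ∑ a, (p a).toReal = 1 := by
  rw [← ENNReal.toReal_sum fun a _ => p.apply_ne_top a, ← tsum_fintype (L := .unconditional _),
    p.tsum_coe, ENNReal.toReal_one]

theorem Strategy.weight_mem {i : Fin 3} (σ : Strategy G i) {n : ℕ} (h : History V n) :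
    σ.weight h ∈ stdSimplex ℝ (moves G i h.last) := by
  refine ⟨fun a => ENNReal.toReal_nonneg, ?_⟩
  simpa [sum_toReal_eq_one] using (σ.sum_prob_mul h fun _ => 1).symm

/-- Allows optimal mixed actions, chosen separately after each history, to be glued into one
strategy. -/
theorem exists_strategy_weight_eq {i : Fin 3}
    (x : (n : ℕ) → (h : History V n) → moves G i h.last → ℝ)
    (hx : ∀ n h, x n h ∈ stdSimplex ℝ (moves G i (History.last h))) :
    ∃ σ : Strategy G i, ∀ n (h : History V n), σ.weight h = x n h := by
  classical
  refine ⟨⟨fun n h => PMF.ofFinset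
    (fun a => if ha : a ∈ moves G i h.last then ENNReal.ofReal (x n h ⟨a, ha⟩) else 0)
    (moves G i h.last) ?_ fun a ha => dif_neg ha, fun n h a => ?_⟩, fun n h => ?_⟩
  · rw [← Finset.sum_coe_sort]
    simp only [Finset.coe_mem, dite_true, Subtype.coe_eta]
    rw [← ENNReal.ofReal_sum_of_nonneg fun a _ => (hx n h).1 a, (hx n h).2, ENNReal.ofReal_one]
  · rw [PMF.ofFinset_apply]
    contrapose
    exact fun ha => by simp [ha]
  · ext a
    simp [Strategy.weight, PMF.ofFinset_apply, (hx n h).1 a]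

/-- The one-stage matrix game after the history `h`, with continuation payoff `W`. -/
noncomputable def stageMatrix (σ₃ : Strategy G 2) {n : ℕ} (h : History V n) (W : State V → ℝ)
    (a₁ : moves G 0 h.last) (a₂ : moves G 1 h.last) : ℝ :=
  q h.last + ∑ s' : State V, (nextState h.last (σ₃.prob n h) a₁ a₂ s').toReal * W s'

theorem stageMatrix_mono (σ₃ : Strategy G 2) {n : ℕ} (h : History V n) {W W' : State V → ℝ}
    (hW : ∀ s, W s ≤ W' s) (a₁ a₂) : stageMatrix σ₃ h W a₁ a₂ ≤ stageMatrix σ₃ h W' a₁ a₂ :=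
  add_le_add_right (Finset.sum_le_sum fun s _ =>
    mul_le_mul_of_nonneg_left (hW s) ENNReal.toReal_nonneg) _

theorem stageMatrix_add_const (σ₃ : Strategy G 2) {n : ℕ} (h : History V n) (W : State V → ℝ)
    (c : ℝ) (a₁ a₂) :
    stageMatrix σ₃ h (fun s => W s + c) a₁ a₂ = stageMatrix σ₃ h W a₁ a₂ + c := by
  simp only [stageMatrix, mul_add, Finset.sum_add_distrib, ← Finset.sum_mul, sum_toReal_eq_one,
    one_mul, add_assoc]

theorem stageMatrix_zero (σ₃ : Strategy G 2) {n : ℕ} (h : History V n) :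
    stageMatrix σ₃ h (fun _ => 0) = fun _ _ => q h.last := by
  ext; simp [stageMatrix]

theorem nextLaw_apply_toReal (σ₁ : Strategy G 0) (σ₂ : Strategy G 1) (σ₃ : Strategy G 2) {n : ℕ}
    (h : History V n) (s : State V) :
    (nextLaw σ₁ σ₂ σ₃ h s).toReal =
      mixedPayoff (fun (a₁ : moves G 0 h.last) (a₂ : moves G 1 h.last) =>
        (nextState h.last (σ₃.prob n h) a₁ a₂ s).toReal) (σ₁.weight h) (σ₂.weight h) := by
  have hbind : ∀ (p : PMF (Move V)) (f : Move V → PMF (State V)),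
      (p.bind f s).toReal = ∑ a, (p a).toReal * (f a s).toReal := fun p f => by
    rw [PMF.bind_apply, tsum_fintype, ENNReal.toReal_sum fun a _ =>
      ENNReal.mul_ne_top (p.apply_ne_top a) ((f a).apply_ne_top s)]
    simp only [ENNReal.toReal_mul]
  rw [nextLaw, hbind, σ₁.sum_prob_mul h, mixedPayoff_eq_sum_mul]
  refine Finset.sum_congr rfl fun a₁ _ => ?_
  rw [hbind, σ₂.sum_prob_mul h]

/-- Since the cops move independently given the history, the expected continuation is bilinear in
their mixed actions. This turns the martingale inequalities into inequalities about the stage matrix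
game. -/
theorem add_lintegral_nextLaw (σ₁ : Strategy G 0) (σ₂ : Strategy G 1) (σ₃ : Strategy G 2) {n : ℕ}
    (h : History V n) {W : State V → ℝ} (hW : ∀ s, 0 ≤ W s) :
    ENNReal.ofReal (q h.last) +
      ∫⁻ s, ENNReal.ofReal (W s) ∂(nextLaw σ₁ σ₂ σ₃ h).toMeasure =
    ENNReal.ofReal (mixedPayoff (stageMatrix σ₃ h W) (σ₁.weight h) (σ₂.weight h)) := by
  have hint : ∫⁻ s, ENNReal.ofReal (W s) ∂(nextLaw σ₁ σ₂ σ₃ h).toMeasure =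
      ENNReal.ofReal (∑ s, (nextLaw σ₁ σ₂ σ₃ h s).toReal * W s) := by
    rw [lintegral_fintype, ENNReal.ofReal_sum_of_nonneg fun s _ =>
      mul_nonneg ENNReal.toReal_nonneg (hW s)]
    refine Finset.sum_congr rfl fun s _ => ?_
    rw [PMF.toMeasure_apply_singleton _ _ (measurableSet_singleton s),
      ENNReal.ofReal_mul ENNReal.toReal_nonneg, ENNReal.ofReal_toReal (PMF.apply_ne_top _ s),
      mul_comm]
  rw [hint, ← ENNReal.ofReal_add (q_nonneg _) (Finset.sum_nonneg fun s _ =>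
      mul_nonneg ENNReal.toReal_nonneg (hW s))]
  congr 1
  have hst : stageMatrix σ₃ h W = fun (a₁ : moves G 0 h.last) (a₂ : moves G 1 h.last) =>
      (∑ s' : State V, (nextState h.last (σ₃.prob n h) a₁ a₂ s').toReal * W s') + q h.last := by
    ext a₁ a₂; rw [stageMatrix, add_comm]
  rw [hst, mixedPayoff_add_const _ _ (σ₁.weight_mem h) (σ₂.weight_mem h), add_comm]
  congr 1
  simp only [nextLaw_apply_toReal, mixedPayoff, Finset.sum_mul, Finset.mul_sum]
  rw [Finset.sum_comm]
  refine Finset.sum_congr rfl fun a₁ _ => ?_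
  rw [Finset.sum_comm]
  exact Finset.sum_congr rfl fun a₂ _ => Finset.sum_congr rfl fun s _ => mul_assoc _ _ _

end Stage

/-! ### Convergence of value iteration and the value of the game -/

section ValueIteration

variable {V : Type*} [Fintype V] {G : SimpleGraph V}

theorem histValueIter_succ (σ₃ : Strategy G 2) (i : ℕ) {n : ℕ} (h : History V n) :
    histValueIter σ₃ (i + 1) h =
      matrixVal (stageMatrix σ₃ h fun s => histValueIter σ₃ i (h.snoc s)) := rfl

theorem histValueIter_nonneg (σ₃ : Strategy G 2) (i : ℕ) {n : ℕ} (h : History V n) :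
    0 ≤ histValueIter σ₃ i h := by
  induction i generalizing n with
  | zero => exact q_nonneg _
  | succ i ih =>
    rw [histValueIter_succ, ← matrixVal_const (ι := moves G 0 h.last) (κ := moves G 1 h.last) 0]
    exact matrixVal_mono fun a₁ a₂ => add_nonneg (q_nonneg _) (Finset.sum_nonneg fun s _ =>
      mul_nonneg ENNReal.toReal_nonneg (ih _))

/-- The iterate `q` is the stage value with zero continuation, hence at most the next iterate;
monotonicity of the matrix value propagates this. -/
theorem histValueIter_le_succ (σ₃ : Strategy G 2) (i : ℕ) {n : ℕ} (h : History V n) :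
    histValueIter σ₃ i h ≤ histValueIter σ₃ (i + 1) h := by
  induction i generalizing n with
  | zero =>
    rw [histValueIter_succ]
    calc histValueIter σ₃ 0 h = matrixVal (stageMatrix σ₃ h fun _ => 0) := by
          rw [stageMatrix_zero, matrixVal_const]; rfl
      _ ≤ _ := matrixVal_mono (stageMatrix_mono σ₃ h fun s => histValueIter_nonneg σ₃ 0 _)
  | succ i ih =>
    rw [histValueIter_succ, histValueIter_succ σ₃ (i + 1)]
    exact matrixVal_mono (stageMatrix_mono σ₃ h fun s => ih _)

theorem sum_pure_toReal_mul (W : State V → ℝ) :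
    ∑ s, ((PMF.pure (none : State V)) s).toReal * W s = W none := by
  rw [Finset.sum_eq_single none] <;> simp +contextual [PMF.pure_apply]

/-- The bound has to be 0 at `τ`: a uniform bound 1 would not survive the induction at a capture by
the first cop, where `q = 1` is added to the continuation. -/
theorem histValueIter_le (σ₃ : Strategy G 2) (i : ℕ) {n : ℕ} (h : History V n) :
    histValueIter σ₃ i h ≤ h.last.elim 0 fun _ => 1 := by
  induction i generalizing n with
  | zero =>
    change q h.last ≤ _
    rcases h.last with _ | x
    · exact le_rfl
    · exact q_le_one _
  | succ i ih =>
    rw [histValueIter_succ,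
      ← matrixVal_const (ι := moves G 0 h.last) (κ := moves G 1 h.last) (h.last.elim 0 fun _ => 1)]
    refine matrixVal_mono fun a₁ a₂ => (stageMatrix_mono σ₃ h (fun s => ih _) a₁ a₂).trans ?_
    simp only [History.last_snoc, stageMatrix]
    generalize (a₁ : Move V) = b₁, (a₂ : Move V) = b₂
    rcases h.last with _ | x
    · rw [nextState_none, sum_pure_toReal_mul]
      simp [q]
    · by_cases hx : x 0 = x 2
      · rw [nextState_of_capture hx, sum_pure_toReal_mul]
        simp [q, hx]
      · simp only [q, hx, if_false, zero_add]
        refine (Finset.sum_le_sum fun s _ => mul_le_of_le_one_right ENNReal.toReal_nonneg ?_).trans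
          (sum_toReal_eq_one (nextState (some x) (σ₃.prob n h) b₁ b₂)).le
        rcases s with _ | s
        exacts [zero_le_one, le_rfl]

/-- The limit of the value iteration. -/
noncomputable def histValue (σ₃ : Strategy G 2) {n : ℕ} (h : History V n) : ℝ :=
  ⨆ i, histValueIter σ₃ i h

theorem bddAbove_histValueIter (σ₃ : Strategy G 2) {n : ℕ} (h : History V n) :
    BddAbove (Set.range fun i => histValueIter σ₃ i h) :=
  ⟨_, by rintro _ ⟨i, rfl⟩; exact histValueIter_le σ₃ i h⟩

theorem histValueIter_le_histValue (σ₃ : Strategy G 2) (i : ℕ) {n : ℕ} (h : History V n) :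
    histValueIter σ₃ i h ≤ histValue σ₃ h :=
  le_ciSup (bddAbove_histValueIter σ₃ h) i

theorem histValue_nonneg (σ₃ : Strategy G 2) {n : ℕ} (h : History V n) : 0 ≤ histValue σ₃ h :=
  (histValueIter_nonneg σ₃ 0 h).trans (histValueIter_le_histValue σ₃ 0 h)

theorem tendsto_histValueIter (σ₃ : Strategy G 2) {n : ℕ} (h : History V n) :
    Tendsto (fun i => histValueIter σ₃ i h) atTop (𝓝 (histValue σ₃ h)) :=
  tendsto_atTop_ciSup (monotone_nat_of_le_succ fun i => histValueIter_le_succ σ₃ i h)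
    (bddAbove_histValueIter σ₃ h)

/-- There are finitely many successor states, so one index `i` brings the iterates within `ε` of the
limit at all of them. Shifting the continuation by `ε` shifts the stage value by `ε`. -/
theorem matrixVal_stageMatrix_histValue_le (σ₃ : Strategy G 2) {n : ℕ} (h : History V n) :
    matrixVal (stageMatrix σ₃ h fun s => histValue σ₃ (h.snoc s)) ≤ histValue σ₃ h := by
  refine le_of_forall_pos_le_add fun ε hε => ?_
  have hev : ∀ᶠ i in atTop, ∀ s,
      histValue σ₃ (h.snoc s) ≤ histValueIter σ₃ i (h.snoc s) + ε := by
    refine eventually_all.2 fun s => ?_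
    filter_upwards [(tendsto_histValueIter σ₃ (h.snoc s)).eventually_const_lt
      (sub_lt_self _ hε)] with i hi
    linarith
  obtain ⟨i, hi⟩ := hev.exists
  have hle := histValueIter_le_histValue σ₃ (i + 1) h
  rw [histValueIter_succ] at hle
  refine (matrixVal_le_matrixVal_add fun a₁ a₂ => ?_).trans (add_le_add_left hle ε)
  rw [← stageMatrix_add_const]
  exact stageMatrix_mono σ₃ h hi a₁ a₂

theorem exists_forall_J_le_histValue (σ₃ : Strategy G 2) (s₀ : State V) :
    ∃ σ₂ : Strategy G 1, ∀ σ₁ : Strategy G 0,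
      J σ₃ σ₁ σ₂ s₀ ≤ ENNReal.ofReal (histValue σ₃ (History.start s₀)) := by
  choose y hy hy' using fun n (h : History V n) =>
    exists_mixedPayoff_le_matrixVal (stageMatrix σ₃ h fun s => histValue σ₃ (h.snoc s))
  obtain ⟨σ₂, hσ₂⟩ := exists_strategy_weight_eq y hy
  refine ⟨σ₂, fun σ₁ => J_le_of_supermartingale σ₁ σ₂ σ₃ s₀
    (fun n h => ENNReal.ofReal (histValue σ₃ h)) fun n h => ?_⟩
  rw [add_lintegral_nextLaw σ₁ σ₂ σ₃ h fun s => histValue_nonneg σ₃ _, hσ₂]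
  exact ENNReal.ofReal_le_ofReal
    ((hy' n h _ (σ₁.weight_mem h)).trans (matrixVal_stageMatrix_histValue_le σ₃ h))

theorem exists_forall_histValueIter_le_J (σ₃ : Strategy G 2) (s₀ : State V) (N : ℕ) :
    ∃ σ₁ : Strategy G 0, ∀ σ₂ : Strategy G 1,
      ENNReal.ofReal (histValueIter σ₃ N (History.start s₀)) ≤ J σ₃ σ₁ σ₂ s₀ := by
  -- `N - n` is the remaining horizon. At time `N` the weight is still `q`, as the zeroth iterate
  -- counts the current payoff, so `w` vanishes only from time `N + 1`.
  let w : (n : ℕ) → History V n → ℝ := fun n h =>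
    if n ≤ N then histValueIter σ₃ (N - n) h else 0
  have hw : ∀ n h, 0 ≤ w n h := fun n h => by
    simp only [w]; split_ifs
    exacts [histValueIter_nonneg σ₃ _ h, le_rfl]
  have hstep : ∀ n h, w n h ≤ matrixVal (stageMatrix σ₃ h fun s => w (n + 1) (h.snoc s)) := by
    intro n h
    rcases lt_or_ge n N with hn | hn
    · obtain ⟨k, rfl⟩ := Nat.exists_eq_add_of_lt hn
      simp only [w, if_pos hn.le, if_pos (Nat.succ_le_of_lt hn)]
      rw [show n + k + 1 - n = k + 1 by omega, show n + k + 1 - (n + 1) = k by omega,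
        histValueIter_succ]
    · have h0 : (fun s => w (n + 1) (h.snoc s)) = fun _ => 0 :=
        funext fun s => if_neg (by omega)
      rw [h0, stageMatrix_zero, matrixVal_const]
      simp only [w]; split_ifs
      · rw [Nat.sub_eq_zero_of_le hn]; exact le_rfl
      · exact q_nonneg _
  choose x hx hx' using fun n (h : History V n) =>
    exists_matrixVal_le_mixedPayoff (stageMatrix σ₃ h fun s => w (n + 1) (h.snoc s))
  obtain ⟨σ₁, hσ₁⟩ := exists_strategy_weight_eq x hx
  refine ⟨σ₁, fun σ₂ => ?_⟩
  have := le_J_of_submartingale σ₁ σ₂ σ₃ s₀ (fun n h => ENNReal.ofReal (w n h)) (N + 1)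
    (fun n h => ?_) fun h => by simp [w]
  · simpa [w] using this
  · rw [add_lintegral_nextLaw σ₁ σ₂ σ₃ h fun s => hw _ _, hσ₁]
    exact ENNReal.ofReal_le_ofReal ((hstep n h).trans (hx' n h _ (σ₂.weight_mem h)))

theorem isGameValue_histValue (σ₃ : Strategy G 2) (s₀ : State V) :
    IsGameValue σ₃ s₀ (histValue σ₃ (History.start s₀)) := by
  have hlow : ENNReal.ofReal (histValue σ₃ (History.start s₀)) ≤
      ⨆ σ₁ : Strategy G 0, ⨅ σ₂ : Strategy G 1, J σ₃ σ₁ σ₂ s₀ := by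
    -- The strategy of the first cop may vary with `N`, since only a supremum has to be bounded
    -- below.
    refine le_of_tendsto' (ENNReal.tendsto_ofReal (tendsto_histValueIter σ₃ _)) fun N => ?_
    obtain ⟨σ₁, hσ₁⟩ := exists_forall_histValueIter_le_J σ₃ s₀ N
    exact le_iSup_of_le σ₁ (le_iInf hσ₁)
  have hup : (⨅ σ₂ : Strategy G 1, ⨆ σ₁ : Strategy G 0, J σ₃ σ₁ σ₂ s₀) ≤
      ENNReal.ofReal (histValue σ₃ (History.start s₀)) := by
    obtain ⟨σ₂, hσ₂⟩ := exists_forall_J_le_histValue σ₃ s₀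
    exact iInf_le_of_le σ₂ (iSup_le hσ₂)
  have hmid := iSup_iInf_le_iInf_iSup fun (σ₁ : Strategy G 0) (σ₂ : Strategy G 1) =>
    J σ₃ σ₁ σ₂ s₀
  exact ⟨histValue_nonneg σ₃ _, le_antisymm (hmid.trans hup) hlow,
    le_antisymm hup (hlow.trans hmid)⟩

theorem valueIter_last_eq_histValueIter (ρ : StationaryStrategy G 2) (i : ℕ) {n : ℕ}
    (h : History V n) : valueIter ρ i h.last = histValueIter ρ.toStrategy i h := by
  induction i generalizing n with
  | zero =>
    change _ = q h.last
    rcases h.last with _ | x <;> simp [valueIter, q]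
  | succ i ih =>
    rcases hl : h.last with _ | x
    -- At `τ` the stationary iterate is 0 by definition, while the history iterate is a matrix
    -- value, squeezed to 0 by its two bounds.
    · refine le_antisymm (by simpa [valueIter] using histValueIter_nonneg _ _ h) ?_
      simpa [valueIter, hl] using histValueIter_le ρ.toStrategy (i + 1) h
    · have ih' : ∀ s, histValueIter ρ.toStrategy i (h.snoc s) = valueIter ρ i s := fun s => by
        rw [← ih, History.last_snoc]
      rw [histValueIter]
      simp only [ih']
      simp only [StationaryStrategy.toStrategy]
      rw [hl, valueIter]

end ValueIteration

end SCPR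

theorem mainTheorem5 {V : Type*} [Fintype V] (G : SimpleGraph V) :
    (∀ (ρ : SCPR.StationaryStrategy G 2) (x : Fin 3 → V),
      ∃ v : ℝ, SCPR.IsGameValue ρ.toStrategy (some x) v ∧
        Tendsto (fun i : ℕ => SCPR.valueIter ρ i (some x)) atTop (𝓝 v)) ∧
    (∀ (σ₃ : SCPR.Strategy G 2) (x : Fin 3 → V),
      ∃ v : ℝ, SCPR.IsGameValue σ₃ (some x) v ∧
        Tendsto (fun i : ℕ => SCPR.histValueIter σ₃ i (SCPR.History.start (some x)))
          atTop (𝓝 v)) := by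
  have hist : ∀ (σ₃ : SCPR.Strategy G 2) (x : Fin 3 → V), ∃ v : ℝ,
      SCPR.IsGameValue σ₃ (some x) v ∧ Tendsto (fun i : ℕ =>
        SCPR.histValueIter σ₃ i (SCPR.History.start (some x))) atTop (𝓝 v) := fun σ₃ x =>
    ⟨_, SCPR.isGameValue_histValue σ₃ (some x), SCPR.tendsto_histValueIter σ₃ _⟩
  refine ⟨fun ρ x => ?_, hist⟩
  obtain ⟨v, hv, hlim⟩ := hist ρ.toStrategy x
  refine ⟨v, hv, hlim.congr fun i => ?_⟩
  exact (SCPR.valueIter_last_eq_histValueIter ρ i (SCPR.History.start (some x))).symm
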